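/- Let $\mathbb F$ be an algebraically closed field of characteristic $p>3$, let $m=2r$ and $n=2s$ be even positive integers, and let $\underline t=(t_1,\dots,t_m)$ be a tuple of positive integers. Put $\pi_i=p^{t_i}-1$, $\xi=\sum_i\pi_i+n$, $I_0=\{1,\dots,m\}$, $I_1=\{m+1,\dots,m+n\}$, $I=I_0\cup I_1$, and $\mu(i)=\bar 0$ for $i\in I_0$, $\mu(i)=\bar 1$ for $i\in I_1$. Let $\mathcal O(m,n)=\mathcal O(m)\otimes\Lambda(n)$ be the tensor product of the divided power algebra with basis $x^{(\alpha)}$, $\alpha\in\mathbb N^m$ (here $0\in\mathbb N$), and the exterior algebra in $x_{m+1},\dots,x_{m+n}$. It has the basis $x^{(\alpha)}x^u$, where $u=\{i_1<\dots<i_k\}\subseteq I_1$ and $x^u=x_{i_1}\cdots x_{i_k}$, and the superderivations $\partial_i$ ($i\in I$) given by $\partial_i(x^{(\alpha)})=x^{(\alpha-\varepsilon_i)}$ for $i\in I_0$ and $\partial_i(x_k)=\delta_{ik}$ for $i,k\in I_1$, the remaining values on generators being zero. Let $\mathcal O$ be the span of the $x^{(\alpha)}x^u$ with $\alpha_i\le\pi_i$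 for all $i$, graded by $\deg x^{(\alpha)}x^u=|\alpha|+|u|$. Let $W=\{\sum_{i\in I}f_i\partial_i\mid f_i\in\mathcal O\}$ be the Witt Lie superalgebra, which is $\mathbb Z$-graded by $\deg x^{(\alpha)}x^u\partial_j=|\alpha|+|u|-1$ and in which $x^{(\alpha)}x^u\partial_j$ has parity $|u|+\mu(j)$. Let $D_H$ be the linear map with $$D_H(f)=\sum_{i\in I}\tau(i)(-1)^{\mu(i)p(f)}\partial_i(f)\,\partial_{i'}$$ for $f$ homogeneous of parity $p(f)$, where $i'=i+r$ for $1\le i\le r$, $i'=i-r$ for $r<i\le m$, $i'=i+s$ for $m<i\le m+s$, $i'=i-s$ for $m+s<i\le m+2s$, and $\tau(i)=-1$ for $r<i\le m$, $\tau(i)=1$ otherwise. Let $H=\{D_H(f)\mid f\in\bigoplus_{i<\xi}\mathcal O_i\}$ be the Hamiltonian Lie superalgebra, a graded subalgebra of $W$. Write $H_{\bar 0}$ for the even part of $H$ and $W_{\bar 1}$ for the odd part of $W$. **Theorem 4.9.** Let $\phi:H_{\bar 0}\to W_{\bar 1}$ be a derivation, i.e. a linear map with $\phi([x,y])=[\phi(x),y]+[x,\phi(y)]$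 for all $x,y\in H_{\bar 0}$. Suppose that $\phi$ is $\mathbb Z$-homogeneous, i.e. there is $d\in\mathbb Z$ with $\phi((H_{\bar 0})_i)\subseteq(W_{\bar 1})_{i+d}$ for all $i$, and that $\phi$ vanishes on $(H_{\bar 0})_{-1}\oplus(H_{\bar 0})_0$. Then $\phi=0$. -/

import Mathlib

/-!
The modular Lie superalgebras `W(m, n; t)` (Witt) and `H(m, n; t)` (Hamiltonian), realised as
spaces of linear operators on `𝒪(m, n) = 𝒪(m) ⊗ Λ(n)`, the tensor product of the divided power
algebra in `m` variables and the exterior algebra in `n` variables.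
-/

namespace HamiltonianSuper

/-- Labels `(α, u)` of the basis monomials `x^(α) x^u`: `α` is a multi-exponent of the divided power
variables, and `u` is the set of exterior variables that occur. -/
abbrev Idx (m n : ℕ) : Type := (Fin m → ℕ) × Finset (Fin n)

/-- The index set `I = I₀ ∪ I₁` of the variables: `inl i` are the `m` even (divided power) ones and
`inr k` the `n` odd (exterior) ones. -/
abbrev Var (m n : ℕ) : Type := Fin m ⊕ Fin n

/-- The total degree `|α| + |u|` of `x^(α) x^u`. -/
def Idx.deg {m n : ℕ} (a : Idx m n) : ℕ := (∑ i, a.1 i) + a.2.card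

/-- The parity `μ(i)` of a variable (and of `∂_i`): `0` for even, `1` for odd variables. -/
def mu {m n : ℕ} : Var m n → ℕ
  | .inl _ => 0
  | .inr _ => 1

/-- The involution `i ↦ i'` on `N` indices (counted from `0`): it exchanges `i` and `i + ⌊N/2⌋` for
`i < ⌊N/2⌋`, and fixes the last index if `N` is odd. -/
def conj {N : ℕ} (i : Fin N) : Fin N :=
  if h : (i : ℕ) < N / 2 then ⟨i + N / 2, by omega⟩
  else if (i : ℕ) < 2 * (N / 2) then ⟨i - N / 2, by omega⟩
  else i

/-- The involution `i ↦ i'` on `I`; it preserves `I₀` and `I₁`. -/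
def prime {m n : ℕ} : Var m n → Var m n
  | .inl i => .inl (conj i)
  | .inr k => .inr (conj k)

/-- The sign `τ(i)`: it is `-1` on the second half of the even variables and `1` elsewhere. -/
def tau {m n : ℕ} : Var m n → ℤ
  | .inl i => if (i : ℕ) < m / 2 then 1 else -1
  | .inr _ => 1

noncomputable section

variable (F : Type*) [Field F]

/-- The underlying vector space of `𝒪(m, n)`, with basis the monomials `x^(α) x^u`. -/
abbrev Alg (m n : ℕ) : Type _ := Idx m n →₀ F

/-- The basis monomial `x^(α) x^u`; the exterior variables in `x^u` stand in increasing order. -/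
def mon {m n : ℕ} (a : Idx m n) : Alg F m n := Finsupp.single a 1

/-- The product of two basis monomials: `x^(α) x^u · x^(β) x^v` is
`± ∏ i, C(α_i + β_i, α_i) • x^(α+β) x^(u ∪ v)` if `u` and `v` are disjoint and `0` otherwise.
The sign is that of the permutation that sorts `x^u x^v`, given by its number of inversions. -/
def monMul {m n : ℕ} (a b : Idx m n) : Alg F m n :=
  if Disjoint a.2 b.2 then
    ((-1 : F) ^ ((a.2 ×ˢ b.2).filter fun q => q.2 < q.1).card *
      ((∏ i, (a.1 i + b.1 i).choose (a.1 i) : ℕ) : F)) • mon F (a.1 + b.1, a.2 ∪ b.2)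
  else 0

/-- The multiplication of `𝒪(m, n)`, as a bilinear map. -/
def mul {m n : ℕ} : Alg F m n →ₗ[F] Alg F m n →ₗ[F] Alg F m n :=
  Finsupp.linearCombination F fun a => Finsupp.linearCombination F fun b => monMul F a b

/-- The value of `∂_i` on a basis monomial: `∂_i x^(α) x^u = x^(α - ε_i) x^u` for an even variable
(`0` if `α_i = 0`); for an odd variable `∂_k` is the left superderivation, which first moves `x_k` to
the front of `x^u` and then removes it (`0` if `k ∉ u`). -/
def monPartial {m n : ℕ} : Var m n → Idx m n → Alg F m n
  | .inl i, a => if a.1 i = 0 then 0 else mon F (a.1 - Pi.single i 1, a.2)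
  | .inr k, a =>
      if k ∈ a.2 then (-1 : F) ^ (a.2.filter fun l => l < k).card • mon F (a.1, a.2.erase k) else 0

/-- The superderivation `∂_i` of `𝒪(m, n)`. -/
def partialD {m n : ℕ} (i : Var m n) : Module.End F (Alg F m n) :=
  Finsupp.linearCombination F (monPartial F i)

/-- The operator `f ∂_i`, that is `g ↦ f · ∂_i(g)`. -/
def vf {m n : ℕ} (f : Alg F m n) (i : Var m n) : Module.End F (Alg F m n) :=
  (mul F f) ∘ₗ (partialD F i)

/-- The linear map `D_H`, with
`D_H(f) = ∑ i, τ(i) (-1)^(μ(i) p(f)) ∂_i(f) ∂_{i'}` for `f` homogeneous of parity `p(f)`;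
the monomial `x^(α) x^u` has parity `|u|`. -/
def DH {m n : ℕ} : Alg F m n →ₗ[F] Module.End F (Alg F m n) :=
  Finsupp.linearCombination F fun a =>
    ∑ i : Var m n, ((tau i : F) * (-1) ^ (mu i * a.2.card)) • vf F (partialD F i (mon F a)) (prime i)

/-- `α ∈ 𝔸(m; t)`, i.e. `α_i ≤ π_i = p^(t_i) - 1` for all `i` (for prime `p`). -/
def InA {m : ℕ} (p : ℕ) (t : Fin m → ℕ) (α : Fin m → ℕ) : Prop := ∀ i, α i < p ^ t i

/-- The top degree `ξ = |π| + n` of `𝒪(m, n; t)`. -/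
def xi {m : ℕ} (p : ℕ) (t : Fin m → ℕ) (n : ℕ) : ℕ := (∑ i, (p ^ t i - 1)) + n

variable {m : ℕ} (p : ℕ) (t : Fin m → ℕ) (n : ℕ)

/-- `⨁_{i < ξ} 𝒪(m, n; t)_i`, the elements of `𝒪(m, n; t)` without component of top degree. -/
def algBelowTop : Submodule F (Alg F m n) :=
  Submodule.span F {f | ∃ a : Idx m n, InA p t a.1 ∧ a.deg < xi p t n ∧ f = mon F a}

/-- The even part of `W(m, n; t)`. -/
def WEven : Submodule F (Module.End F (Alg F m n)) :=
  Submodule.span F {D | ∃ (a : Idx m n) (j : Var m n),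
    InA p t a.1 ∧ Even (a.2.card + mu j) ∧ D = vf F (mon F a) j}

/-- The odd part of `W(m, n; t)`. -/
def WOdd : Submodule F (Module.End F (Alg F m n)) :=
  Submodule.span F {D | ∃ (a : Idx m n) (j : Var m n),
    InA p t a.1 ∧ Odd (a.2.card + mu j) ∧ D = vf F (mon F a) j}

/-- The homogeneous component of degree `d` of `W(m, n; t)`, spanned by the `x^(α) x^u ∂_j` with
`|α| + |u| = d + 1`. -/
def WDeg (d : ℤ) : Submodule F (Module.End F (Alg F m n)) :=
  Submodule.span F {D | ∃ (a : Idx m n) (j : Var m n),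
    InA p t a.1 ∧ (a.deg : ℤ) = d + 1 ∧ D = vf F (mon F a) j}

/-- The Hamiltonian superalgebra `H(m, n; t)`. -/
def Ham : Submodule F (Module.End F (Alg F m n)) := (algBelowTop F p t n).map (DH F)

/-- The even part of `H(m, n; t)`. -/
def HEven : Submodule F (Module.End F (Alg F m n)) := Ham F p t n ⊓ WEven F p t n

/-- The component of degree `d` of the even part of `H(m, n; t)`. -/
def HEvenDeg (d : ℤ) : Submodule F (HEven F p t n) :=
  (WDeg F p t n d).comap (HEven F p t n).subtype

/-- The component of degree `d` of the odd part of `W(m, n; t)`. -/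
def WOddDeg (d : ℤ) : Submodule F (WOdd F p t n) :=
  (WDeg F p t n d).comap (WOdd F p t n).subtype

variable {F p t n}

/-- `φ` is a derivation from the even part of `H` into the odd part of `W`:
`φ [x, y] = [φ x, y] + [x, φ y]`. In each bracket at least one entry is even, so the bracket of the
Lie superalgebra of operators is the commutator, which is the bracket of `Module.End`. The even part
of `H` is closed under it, `z` stands for `[x, y]`. -/
def IsDerivation (φ : HEven F p t n →ₗ[F] WOdd F p t n) : Prop :=
  ∀ x y z : HEven F p t n, (z : Module.End F (Alg F m n)) = ⁅x.1, y.1⁆ →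
    (φ z).1 = ⁅(φ x).1, y.1⁆ + ⁅x.1, (φ y).1⁆

/-- `φ` is homogeneous for the `ℤ`-gradings: it shifts all degrees by the same integer `d`. -/
def IsHomogeneous (φ : HEven F p t n →ₗ[F] WOdd F p t n) : Prop :=
  ∃ d : ℤ, ∀ i : ℤ, ∀ x ∈ HEvenDeg F p t n i, φ x ∈ WOddDeg F p t n (i + d)

end

end HamiltonianSuper

namespace HamiltonianSuper

noncomputable section

variable {F : Type*} [Field F] {m n : ℕ}

/-! The parity of an element of `W` can be read off from the adjoint action of a torus inside the
even part of `H`, so a `φ` commuting with that action cannot change parity. For each pair of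
conjugate odd variables `k, k'`, the element `D_H(x_k x_{k'}) = x_{k'} ∂_{k'} - x_k ∂_k` is even of
degree 0 (`DH_torusIdx`, `torus_mem`). Since `φ` kills it, the derivation rule makes `φ` commute
with its adjoint action (`adDiag_mem_intertwiners`). On `x^(α) x^u ∂_j` this action has an
eigenvalue `w` in `{0, ±1, ±2}`, with `w` congruent mod 2 to the number of occurrences of `k` and
`k'`. A quartic turns `w` into `(-1)^w`, and the product over all pairs is the parity operator: `1`
on even and `-1` on odd elements (`parityOp_vf`). It too commutes with `φ`, so `φ x = -φ x`, and `φ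
x = 0` because `2` is invertible. -/

/-! ### Diagonal operators and the weights of vector fields. -/

/-- The operator scaling the monomial `x^(α) x^u` by `∑ k ∈ u, χ k`. -/
def diag (χ : Fin n → F) : Module.End F (Alg F m n) :=
  Finsupp.linearCombination F fun b => (∑ k ∈ b.2, χ k) • mon F b

/-- The weight of a variable with respect to weights `χ` of the odd variables. -/
def varWeight (χ : Fin n → F) : Var m n → F
  | .inl _ => 0
  | .inr k => χ k

@[simp] lemma diag_mon (χ : Fin n → F) (b : Idx m n) :
    diag χ (mon F b) = (∑ k ∈ b.2, χ k) • mon F b := by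
  simp [diag, mon]

@[simp] lemma partialD_mon (i : Var m n) (b : Idx m n) :
    partialD F i (mon F b) = monPartial F i b := by
  simp [partialD, mon]

lemma vf_zero (j : Var m n) : vf F (0 : Alg F m n) j = 0 := by
  simp [vf]

lemma vf_smul (c : F) (f : Alg F m n) (j : Var m n) : vf F (c • f) j = c • vf F f j := by
  simp [vf, LinearMap.smul_comp]

lemma mul_mon (a b : Idx m n) : mul F (mon F a) (mon F b) = monMul F a b := by
  simp [mul, mon]

lemma alg_hom_ext {A B : Module.End F (Alg F m n)} (h : ∀ b, A (mon F b) = B (mon F b)) :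
    A = B :=
  Finsupp.lhom_ext' fun b => LinearMap.ext_ring (h b)

lemma monMul_weight (χ : Fin n → F) (a b : Idx m n) :
    diag χ (monMul F a b) = (∑ k ∈ a.2, χ k + ∑ k ∈ b.2, χ k) • monMul F a b := by
  unfold monMul
  split_ifs with h
  · simp only [map_smul, diag_mon, Finset.sum_union h]
    rw [smul_comm]
  · simp

lemma diag_vf_mon (χ : Fin n → F) (a b : Idx m n) (j : Var m n) :
    diag χ (vf F (mon F a) j (mon F b)) =
      (∑ k ∈ a.2, χ k + ∑ k ∈ b.2, χ k - varWeight χ j) • vf F (mon F a) j (mon F b) := by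
  rcases j with i | l
  · simp only [vf, LinearMap.comp_apply, partialD_mon, monPartial, varWeight, sub_zero]
    split_ifs
    · simp
    · rw [mul_mon, monMul_weight]
  · simp only [vf, LinearMap.comp_apply, partialD_mon, monPartial, varWeight]
    split_ifs with h
    · rw [map_smul, map_smul, mul_mon, monMul_weight, smul_comm, Finset.sum_erase_eq_sub h,
        add_sub_assoc]
    · simp

lemma ring_lie_add {A : Type*} [Ring A] (a b c : A) : ⁅a, b + c⁆ = ⁅a, b⁆ + ⁅a, c⁆ := by
  simp only [Ring.lie_def, mul_add, add_mul]
  abel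

lemma ring_lie_smul {A : Type*} [Ring A] [Algebra F A] (a b : A) (c : F) :
    ⁅a, c • b⁆ = c • ⁅a, b⁆ := by
  simp only [Ring.lie_def, mul_smul_comm, smul_mul_assoc, smul_sub]

lemma ring_zero_lie_add {A : Type*} [Ring A] (a b : A) : ⁅(0 : A), a⁆ + b = b := by
  simp [Ring.lie_def]

/-- The commutator with `diag χ`. -/
def adDiag (χ : Fin n → F) : Module.End F (Module.End F (Alg F m n)) where
  toFun D := ⁅diag χ, D⁆
  map_add' A B := ring_lie_add _ A B
  map_smul' c A := ring_lie_smul _ A c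

/-- The operator `x^(α) x^u ∂_j` shifts weights by a constant: multiplication adds the weight of
`u`, and `∂_j` removes that of `j`. Hence it is an eigenvector of the commutator with `diag χ`. -/
lemma adDiag_vf (χ : Fin n → F) (a : Idx m n) (j : Var m n) :
    adDiag χ (vf F (mon F a) j) = (∑ k ∈ a.2, χ k - varWeight χ j) • vf F (mon F a) j := by
  refine alg_hom_ext fun b => ?_
  change (⁅(diag χ : Module.End F (Alg F m n)), vf F (mon F a) j⁆) (mon F b) = _
  rw [Ring.lie_def, LinearMap.sub_apply, Module.End.mul_apply, Module.End.mul_apply, diag_vf_mon,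
    diag_mon, map_smul, LinearMap.smul_apply, ← sub_smul]
  congr 1
  ring

/-- The weights removed by `∂_i` and by `∂_{i'}` are opposite by `hχ` and cancel, so all terms of
`D_H(x^a)` share one weight. This keeps `H` stable under the torus. -/
lemma adDiag_vf_partialD (χ : Fin n → F) (hχ : ∀ k, χ (conj k) = -χ k) (a : Idx m n)
    (i : Var m n) :
    adDiag χ (vf F (partialD F i (mon F a)) (prime i)) =
      (∑ k ∈ a.2, χ k) • vf F (partialD F i (mon F a)) (prime i) := by
  rw [partialD_mon]
  rcases i with i | l
  · simp only [monPartial, prime]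
    split_ifs
    · simp [vf_zero]
    · rw [adDiag_vf]
      simp [varWeight]
  · simp only [monPartial, prime]
    split_ifs with h
    · rw [vf_smul, map_smul, adDiag_vf, Finset.sum_erase_eq_sub h, smul_comm]
      simp [varWeight, hχ]
    · simp [vf_zero]

lemma adDiag_DH (χ : Fin n → F) (hχ : ∀ k, χ (conj k) = -χ k) (a : Idx m n) :
    adDiag χ (DH F (mon F a)) = (∑ k ∈ a.2, χ k) • DH F (mon F a) := by
  simp only [DH, mon, Finsupp.linearCombination_single, one_smul]
  rw [map_sum, Finset.smul_sum]
  refine Finset.sum_congr rfl fun i _ => ?_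
  rw [map_smul, smul_comm]
  congr 1
  exact adDiag_vf_partialD χ hχ a i

lemma adDiag_mem_Ham (χ : Fin n → F) (hχ : ∀ k, χ (conj k) = -χ k) {p : ℕ} {t : Fin m → ℕ}
    {D : Module.End F (Alg F m n)} (hD : D ∈ Ham F p t n) : adDiag χ D ∈ Ham F p t n := by
  obtain ⟨f, hf, rfl⟩ := hD
  induction hf using Submodule.span_induction with
  | mem f hf =>
    obtain ⟨a, ha, hd, rfl⟩ := hf
    rw [adDiag_DH χ hχ]
    exact Submodule.smul_mem _ _ ⟨_, Submodule.subset_span ⟨a, ha, hd, rfl⟩, rfl⟩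
  | zero => simp
  | add f g _ _ hf hg => simpa only [map_add] using Submodule.add_mem _ hf hg
  | smul c f _ hf => simpa only [map_smul] using Submodule.smul_mem _ c hf

lemma adDiag_mem_WEven (χ : Fin n → F) {p : ℕ} {t : Fin m → ℕ}
    {D : Module.End F (Alg F m n)} (hD : D ∈ WEven F p t n) : adDiag χ D ∈ WEven F p t n := by
  induction hD using Submodule.span_induction with
  | mem D hD =>
    obtain ⟨a, j, ha, he, rfl⟩ := hD
    rw [adDiag_vf]
    exact Submodule.smul_mem _ _ (Submodule.subset_span ⟨a, j, ha, he, rfl⟩)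
  | zero => simp
  | add f g _ _ hf hg => simpa only [map_add] using Submodule.add_mem _ hf hg
  | smul c f _ hf => simpa only [map_smul] using Submodule.smul_mem _ c hf

lemma vf_inr_self (k : Fin n) :
    vf F (mon F ((0, {k}) : Idx m n)) (.inr k) = diag (Pi.single k 1) := by
  refine alg_hom_ext fun b => ?_
  rw [diag_mon]
  simp only [vf, LinearMap.comp_apply, partialD_mon, monPartial]
  simp only [Pi.single_apply, Finset.sum_ite_eq']
  split_ifs with h
  · rw [map_smul, mul_mon, monMul, if_pos (by simp)]
    -- Sorting `x_k` back into place costs the same sign as `∂_k` paid to extract it, so the signs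
    -- cancel.
    have hc : ((({k} : Finset (Fin n)) ×ˢ b.2.erase k).filter fun q => q.2 < q.1).card =
        (b.2.filter fun l => l < k).card := by
      refine Finset.card_nbij' (fun q => q.2) (fun l => (k, l)) ?_ ?_ ?_ ?_
      · rintro ⟨x, y⟩; simp +contextual
      · intro l; simp +contextual [ne_of_lt]
      · rintro ⟨x, y⟩; simp +contextual
      · intro l; simp
    have hu : {k} ∪ b.2.erase k = b.2 := by
      rw [← Finset.insert_eq, Finset.insert_erase h]
    simp only [hc, hu, smul_smul]
    simp [← mul_pow]
  · simp

/-! ### Polynomials in an operator, and operators compatible with `φ`. -/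

/-- The quartic with value `(-1) ^ w` at `w = 0, ±1, ±2`. -/
def signQuartic : Polynomial F :=
  1 - Polynomial.C (8 / 3) * Polynomial.X ^ 2 + Polynomial.C (2 / 3) * Polynomial.X ^ 4

/-- The operators leaving the graph of `φ` stable. -/
def intertwiners {M : Type*} [AddCommMonoid M] [Module F M] {V W : Submodule F M}
    (φ : V →ₗ[F] W) : Subalgebra F (Module.End F M) where
  carrier := {A | ∀ x : V, ∃ y : V, y.1 = A x.1 ∧ (φ y).1 = A (φ x).1}
  mul_mem' := by
    intro A B hA hB x
    obtain ⟨y, h1, h2⟩ := hB x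
    obtain ⟨z, h3, h4⟩ := hA y
    exact ⟨z, by simp [h3, h1], by simp [h4, h2]⟩
  add_mem' := by
    intro A B hA hB x
    obtain ⟨y, h1, h2⟩ := hB x
    obtain ⟨z, h3, h4⟩ := hA x
    exact ⟨z + y, by simp [h3, h1], by simp [h4, h2]⟩
  algebraMap_mem' := by
    intro c x
    exact ⟨c • x, by simp, by simp⟩

lemma aeval_apply_of_apply_eq_smul {M : Type*} [AddCommMonoid M] [Module F M] {A : Module.End F M}
    {c : F} {x : M} (h : A x = c • x) (q : Polynomial F) :
    Polynomial.aeval A q x = q.eval c • x := by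
  have hpow (k : ℕ) : (A ^ k) x = c ^ k • x := by
    induction k with
    | zero => simp
    | succ k ih => rw [pow_succ, Module.End.mul_apply, h, map_smul, ih, smul_smul, pow_succ']
  induction q using Polynomial.induction_on' with
  | add q r hq hr => simp [hq, hr, add_smul]
  | monomial k a => simp [Polynomial.aeval_monomial, hpow, smul_smul, mul_comm]

lemma list_prod_map_apply_of_apply_eq_smul {M ι : Type*} [AddCommMonoid M] [Module F M]
    {A : ι → Module.End F M} {c : ι → F} {x : M} (h : ∀ i, A i x = c i • x) (l : List ι) :
    (l.map A).prod x = (l.map c).prod • x := by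
  induction l with
  | nil => simp
  | cons i l ih => simp [ih, h, smul_smul, mul_comm]

/-! ### The torus spanned by the `D_H(x_k x_{k'})`. -/

/-- The `i`-th odd variable of the first half. -/
def oddFst {s : ℕ} (i : Fin s) : Fin (s + s) := Fin.castAdd s i

/-- The conjugate of `oddFst i`. -/
def oddSnd {s : ℕ} (i : Fin s) : Fin (s + s) := Fin.natAdd s i

lemma oddFst_injective {s : ℕ} : Function.Injective (oddFst : Fin s → Fin (s + s)) :=
  Fin.castAdd_injective s s

lemma oddSnd_injective {s : ℕ} : Function.Injective (oddSnd : Fin s → Fin (s + s)) :=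
  Fin.natAdd_injective s s

lemma conj_oddFst {s : ℕ} (i : Fin s) : conj (oddFst i) = oddSnd i := by
  have h : ((oddFst i : Fin (s + s)) : ℕ) = i := rfl
  rw [conj, dif_pos (by omega)]
  ext
  simp only [h, oddSnd, Fin.val_natAdd]
  omega

lemma conj_oddSnd {s : ℕ} (i : Fin s) : conj (oddSnd i) = oddFst i := by
  have h : ((oddSnd i : Fin (s + s)) : ℕ) = s + i := rfl
  rw [conj, dif_neg (by omega), if_pos (by omega)]
  ext
  simp only [h, oddFst, Fin.val_castAdd]
  omega

/-- The weights of `D_H(x_k x_{k'})`, where `k` is the `i`-th odd variable. -/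
def torusWeight {s : ℕ} (i : Fin s) : Fin (s + s) → F :=
  Pi.single (oddSnd i) 1 - Pi.single (oddFst i) 1

lemma oddFst_ne_oddSnd {s : ℕ} (i j : Fin s) : oddFst i ≠ oddSnd j := by
  intro h
  have := congrArg Fin.val h
  have := i.2
  simp [oddFst, oddSnd] at *
  omega

lemma torusWeight_conj {s : ℕ} (i : Fin s) (k : Fin (s + s)) :
    (torusWeight i (conj k) : F) = -torusWeight i k := by
  refine Fin.addCases (fun j => ?_) (fun j => ?_) k
  · change torusWeight i (conj (oddFst j)) = -torusWeight i (oddFst j)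
    simp [conj_oddFst, torusWeight, Pi.single_apply, oddFst_ne_oddSnd,
      (oddFst_ne_oddSnd _ _).symm, oddFst_injective.eq_iff, oddSnd_injective.eq_iff]
  · change torusWeight i (conj (oddSnd j)) = -torusWeight i (oddSnd j)
    simp [conj_oddSnd, torusWeight, Pi.single_apply, oddFst_ne_oddSnd,
      (oddFst_ne_oddSnd _ _).symm, oddFst_injective.eq_iff, oddSnd_injective.eq_iff]

lemma diag_torusWeight {s : ℕ} (i : Fin s) :
    (diag (torusWeight i) : Module.End F (Alg F m (s + s))) =
      vf F (mon F (0, {oddSnd i})) (.inr (oddSnd i)) +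
        (-1 : F) • vf F (mon F (0, {oddFst i})) (.inr (oddFst i)) := by
  rw [vf_inr_self, vf_inr_self]
  refine alg_hom_ext fun b => ?_
  simp only [LinearMap.add_apply, LinearMap.smul_apply, diag_mon, torusWeight, Pi.sub_apply,
    Finset.sum_sub_distrib, smul_smul, ← add_smul]
  congr 1
  ring

/-- The index of the monomial `x_k x_{k'}`, where `k` is the `i`-th odd variable. -/
def torusIdx (m : ℕ) {s : ℕ} (i : Fin s) : Idx m (s + s) :=
  (0, {oddFst i, oddSnd i})

/-- Only two partial derivatives of `x_k x_{k'}` survive; `∂_{k'}` has to pass `x_k`, which gives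
the minus sign. -/
lemma DH_torusIdx {s : ℕ} (i : Fin s) :
    DH F (mon F (torusIdx m i)) = (diag (torusWeight i) : Module.End F (Alg F m (s + s))) := by
  have hne := oddFst_ne_oddSnd i i
  have hlt : oddFst i < oddSnd i := by
    rw [Fin.lt_def]
    have := i.2
    simp [oddFst, oddSnd]
    omega
  have hcard : (torusIdx m i).2.card = 2 := Finset.card_pair hne
  have h1 : partialD F (.inr (oddFst i)) (mon F (torusIdx m i)) =
      mon F (0, {oddSnd i}) := by
    have he : (({oddFst i, oddSnd i} : Finset _).erase (oddFst i)) =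
        {oddSnd i} := by
      rw [Finset.erase_insert (by simpa using hne)]
    simp [partialD_mon, monPartial, torusIdx, he, Finset.filter_insert, Finset.filter_singleton,
      hlt.not_gt]
  have h2 : partialD F (.inr (oddSnd i)) (mon F (torusIdx m i)) =
      (-1 : F) • mon F (0, {oddFst i}) := by
    have he : (({oddFst i, oddSnd i} : Finset _).erase (oddSnd i)) =
        {oddFst i} := by
      rw [Finset.pair_comm, Finset.erase_insert (by simpa using hne.symm)]
    simp [partialD_mon, monPartial, torusIdx, he, Finset.filter_insert, Finset.filter_singleton,
      hlt]
  have hl : ∀ j, partialD F (.inl j) (mon F (torusIdx m i)) = 0 := by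
    intro j
    simp [partialD_mon, monPartial, torusIdx]
  have hr : ∀ l, l ≠ oddFst i ∧ l ≠ oddSnd i →
      partialD F (.inr l) (mon F (torusIdx m i)) = 0 := by
    rintro l ⟨hl1, hl2⟩
    simp [partialD_mon, monPartial, torusIdx, hl1, hl2]
  rw [diag_torusWeight]
  conv_lhs => rw [DH, mon, Finsupp.linearCombination_single, one_smul, Fintype.sum_sum_type]
  simp only [hl, vf_zero, smul_zero, Finset.sum_const_zero, zero_add, hcard]
  rw [Fintype.sum_eq_add _ _ hne (fun l hl => by rw [hr l hl, vf_zero, smul_zero]), h1, h2]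
  rw [vf_smul]
  simp only [tau, mu, prime, conj_oddFst, conj_oddSnd, Int.cast_one, one_mul, even_two.neg_one_pow,
    one_smul]

lemma torus_mem {s : ℕ} {p : ℕ} (hp : 3 < p) (hm : 0 < m) {t : Fin m → ℕ} (ht : ∀ i, 0 < t i)
    (i : Fin s) : ∃ h : HEven F p t (s + s),
      h.1 = diag (torusWeight i) ∧ h ∈ HEvenDeg F p t (s + s) 0 := by
  have hA : InA p t 0 := fun j => pow_pos (by omega) _
  have hd : (torusIdx m i).deg = 2 := by
    simp [Idx.deg, torusIdx, Finset.card_pair (oddFst_ne_oddSnd i i)]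
  -- `x_k x_{k'}` must lie below the top degree: one even variable contributes at least `p - 1` to
  -- `ξ`, and the odd ones at least 2.
  have hx : 2 < xi p t (s + s) := by
    have h1 : p ≤ p ^ t ⟨0, hm⟩ := Nat.le_self_pow (ht _).ne' p
    have h2 := Finset.single_le_sum (f := fun j => p ^ t j - 1) (fun _ _ => Nat.zero_le _)
      (Finset.mem_univ (⟨0, hm⟩ : Fin m))
    have h3 : 1 ≤ s := i.pos
    simp only [xi] at *
    omega
  have hH : (diag (torusWeight i) : Module.End F (Alg F m (s + s))) ∈ Ham F p t (s + s) :=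
    ⟨_, Submodule.subset_span ⟨torusIdx m i, hA, by omega, rfl⟩, DH_torusIdx i⟩
  have hE : (diag (torusWeight i) : Module.End F (Alg F m (s + s))) ∈ WEven F p t (s + s) := by
    rw [diag_torusWeight]
    exact Submodule.add_mem _ (Submodule.subset_span ⟨_, _, hA, by simp [mu], rfl⟩)
      (Submodule.smul_mem _ _ (Submodule.subset_span ⟨_, _, hA, by simp [mu], rfl⟩))
  refine ⟨⟨_, hH, hE⟩, rfl, ?_⟩
  change (diag (torusWeight i) : Module.End F (Alg F m (s + s))) ∈ WDeg F p t (s + s) 0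
  rw [diag_torusWeight]
  exact Submodule.add_mem _ (Submodule.subset_span ⟨_, _, hA, by simp [Idx.deg], rfl⟩)
    (Submodule.smul_mem _ _ (Submodule.subset_span ⟨_, _, hA, by simp [Idx.deg], rfl⟩))

/-! ### The parity operator. -/

/-- The factor `(-1) ^ w` of the parity operator, where `w` is the weight of the torus element
`D_H(x_k x_{k'})` and `k` is the `i`-th odd variable. -/
def signFactor (m : ℕ) {s : ℕ} (i : Fin s) : Module.End F (Module.End F (Alg F m (s + s))) :=
  Polynomial.aeval (adDiag (torusWeight i)) (signQuartic (F := F))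

/-- The operator acting as `1` on the even and as `-1` on the odd part of `W`, written as a
polynomial in the adjoint action of the torus. -/
def parityOp (F : Type*) [Field F] (m s : ℕ) : Module.End F (Module.End F (Alg F m (s + s))) :=
  ((List.finRange s).map (signFactor m)).prod

/-- The number of occurrences of the odd variable `k` in `x^(α) x^u ∂_j`, counting `∂_k` as one. -/
def occ (u : Finset (Fin n)) (j : Var m n) (k : Fin n) : ℕ :=
  (if k ∈ u then 1 else 0) + (if j = .inr k then 1 else 0)

lemma sum_occ (u : Finset (Fin n)) (j : Var m n) : ∑ k, occ u j k = u.card + mu j := by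
  rcases j with i | l <;> simp [occ, Finset.sum_add_distrib, mu]

/-- The weight is a signed count of the occurrences on the right, so both have the same parity. The
denominators of the quartic are why `3` must be invertible. -/
lemma signQuartic_eval_torusWeight (h3 : (3 : F) ≠ 0) {s : ℕ} (i : Fin s)
    (u : Finset (Fin (s + s))) (j : Var m (s + s)) :
    signQuartic.eval (∑ k ∈ u, torusWeight i k - varWeight (torusWeight i) j) =
      (-1 : F) ^ (occ u j (oddFst i) + occ u j (oddSnd i)) := by
  have hne := oddFst_ne_oddSnd i i
  have hsum : ∑ k ∈ u, (torusWeight i k : F) =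
      (if oddSnd i ∈ u then 1 else 0) - (if oddFst i ∈ u then 1 else 0) := by
    simp [torusWeight, Pi.single_apply]
  have hvar : varWeight (torusWeight i) j =
      (if j = .inr (oddSnd i) then 1 else 0) -
        (if j = .inr (oddFst i) then (1 : F) else 0) := by
    rcases j with l | l <;> simp [varWeight, torusWeight, Pi.single_apply]
  have hboth : ¬ (j = .inr (oddSnd i) ∧ j = .inr (oddFst i)) := by
    rintro ⟨h, h'⟩
    exact hne (Sum.inr_injective (h'.symm.trans h))
  rw [hsum, hvar]
  simp only [signQuartic, occ, Polynomial.eval_add, Polynomial.eval_sub, Polynomial.eval_mul,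
    Polynomial.eval_one, Polynomial.eval_C, Polynomial.eval_pow, Polynomial.eval_X]
  split_ifs <;> first | (exfalso; tauto) | (field_simp; norm_num)

lemma parityOp_vf (h3 : (3 : F) ≠ 0) {s : ℕ} (a : Idx m (s + s))
    (j : Var m (s + s)) :
    parityOp F m s (vf F (mon F a) j) = (-1 : F) ^ (a.2.card + mu j) • vf F (mon F a) j := by
  have key (i : Fin s) : signFactor m i (vf F (mon F a) j) =
      (-1 : F) ^ (occ a.2 j (oddFst i) + occ a.2 j (oddSnd i)) •
        vf F (mon F a) j := by
    rw [← signQuartic_eval_torusWeight h3]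
    exact aeval_apply_of_apply_eq_smul (adDiag_vf (torusWeight i) a j) signQuartic
  -- The pairs exhaust the odd variables, so the exponents add up to the total number of
  -- occurrences, `|u| + μ(j)`.
  rw [parityOp, list_prod_map_apply_of_apply_eq_smul key, ← Fin.prod_univ_def,
    Finset.prod_pow_eq_pow_sum, Finset.sum_add_distrib, ← sum_occ, Fin.sum_univ_add]
  rfl

lemma parityOp_of_mem_WEven (h3 : (3 : F) ≠ 0) {s p : ℕ} {t : Fin m → ℕ}
    {D : Module.End F (Alg F m (s + s))} (hD : D ∈ WEven F p t (s + s)) :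
    parityOp F m s D = D := by
  induction hD using Submodule.span_induction with
  | mem D hD =>
    obtain ⟨a, j, -, he, rfl⟩ := hD
    rw [parityOp_vf h3, he.neg_one_pow, one_smul]
  | zero => simp
  | add f g _ _ hf hg => rw [map_add, hf, hg]
  | smul c f _ hf => rw [map_smul, hf]

lemma parityOp_of_mem_WOdd (h3 : (3 : F) ≠ 0) {s p : ℕ} {t : Fin m → ℕ}
    {D : Module.End F (Alg F m (s + s))} (hD : D ∈ WOdd F p t (s + s)) :
    parityOp F m s D = (-1 : F) • D := by
  induction hD using Submodule.span_induction with
  | mem D hD =>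
    obtain ⟨a, j, -, ho, rfl⟩ := hD
    rw [parityOp_vf h3, ho.neg_one_pow]
  | zero => simp
  | add f g _ _ hf hg => rw [map_add, hf, hg, smul_add]
  | smul c f _ hf => rw [map_smul, hf, smul_comm]

lemma adDiag_mem_intertwiners {s p : ℕ} (hp : 3 < p) (hm : 0 < m) {t : Fin m → ℕ}
    (ht : ∀ i, 0 < t i) {φ : HEven F p t (s + s) →ₗ[F] WOdd F p t (s + s)}
    (hder : IsDerivation φ) (hvan : ∀ x ∈ HEvenDeg F p t (s + s) 0, φ x = 0) (i : Fin s) :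
    adDiag (torusWeight i) ∈
      intertwiners φ := by
  intro x
  obtain ⟨h, hh, h0⟩ := torus_mem (F := F) hp hm ht i
  refine ⟨⟨adDiag (torusWeight i) x.1,
    adDiag_mem_Ham _ (torusWeight_conj i) x.2.1, adDiag_mem_WEven _ x.2.2⟩, rfl, ?_⟩
  -- As `φ h = 0`, the derivation rule reduces to `φ [h, x] = [h, φ x]`.
  rw [hder h x _ (by rw [hh]; rfl), hvan h h0, hh]
  exact ring_zero_lie_add x.1 ⁅(diag (torusWeight i) : Module.End F (Alg F m (s + s))), (φ x).1⁆

lemma parityOp_mem_intertwiners {s p : ℕ} (hp : 3 < p) (hm : 0 < m) {t : Fin m → ℕ}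
    (ht : ∀ i, 0 < t i) {φ : HEven F p t (s + s) →ₗ[F] WOdd F p t (s + s)}
    (hder : IsDerivation φ) (hvan : ∀ x ∈ HEvenDeg F p t (s + s) 0, φ x = 0) :
    parityOp F m s ∈ intertwiners φ := by
  refine Subalgebra.list_prod_mem _ fun A hA => ?_
  obtain ⟨i, -, rfl⟩ := List.mem_map.1 hA
  exact Polynomial.aeval_mem_adjoin_singleton F _ |> Algebra.adjoin_le
    (Set.singleton_subset_iff.2 (adDiag_mem_intertwiners hp hm ht hder hvan i))

end

end HamiltonianSuper

theorem theorem4p9 {F : Type*} [Field F] [IsAlgClosed F] (p : ℕ) [CharP F p] (hp : 3 < p)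
    (m n : ℕ) (hm : 0 < m) (hm_even : Even m) (hn : 0 < n) (hn_even : Even n)
    (t : Fin m → ℕ) (ht : ∀ i, 0 < t i)
    (φ : HamiltonianSuper.HEven F p t n →ₗ[F] HamiltonianSuper.WOdd F p t n)
    (hφ_der : HamiltonianSuper.IsDerivation φ)
    (hφ_hom : HamiltonianSuper.IsHomogeneous φ)
    (hφ_van : ∀ x ∈ HamiltonianSuper.HEvenDeg F p t n (-1) ⊔ HamiltonianSuper.HEvenDeg F p t n 0,
      φ x = 0) :
    φ = 0 := by
  obtain ⟨s, rfl⟩ := hn_even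
  have ne_zero (k : ℕ) (hk : 0 < k) (hkp : k < p) : (k : F) ≠ 0 := fun h =>
    Nat.not_dvd_of_pos_of_lt hk hkp ((CharP.cast_eq_zero_iff F p k).1 h)
  have h2 : (2 : F) ≠ 0 := mod_cast ne_zero 2 (by omega) (by omega)
  have h3 : (3 : F) ≠ 0 := mod_cast ne_zero 3 (by omega) (by omega)
  refine LinearMap.ext fun x => Subtype.ext ?_
  -- The parity operator sends the point `(x, φ x)` of the graph to `(x, -φ x)`, which again lies on
  -- the graph.
  obtain ⟨y, hy, hφy⟩ := HamiltonianSuper.parityOp_mem_intertwiners hp hm ht hφ_der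
    (fun x hx => hφ_van x (Submodule.mem_sup_right hx)) x
  rw [HamiltonianSuper.parityOp_of_mem_WEven h3 x.2.2] at hy
  rw [Subtype.ext hy, HamiltonianSuper.parityOp_of_mem_WOdd h3 (φ x).2] at hφy
  have h : (2 : F) • (φ x).1 = 0 := by
    calc (2 : F) • (φ x).1 = (1 : F) • (φ x).1 + (φ x).1 := by rw [one_smul, two_smul]
      _ = (1 : F) • (φ x).1 + (-1 : F) • (φ x).1 := by rw [← hφy]
      _ = 0 := by rw [← add_smul, add_neg_cancel, zero_smul]
  calc (φ x).1 = (2 : F)⁻¹ • (2 : F) • (φ x).1 := by rw [smul_smul, inv_mul_cancel₀ h2, one_smul]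
    _ = 0 := by rw [h, smul_zero]
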